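/- Let $1\le d<n$ be integers, and let $\mathrm{Gr}(d,n)$ be the set of $d$-dimensional linear subspaces of $\mathbb R^n$. For $\Sigma\subset\mathrm{Gr}(d,n)$ finite and $f\in L^p(\mathbb R^n)$ put $$ \mathrm M_\Sigma f(x)=\sup_{\sigma\in\Sigma}\int_{\sigma\cap B_n}|f(x-y)|\,\mathrm dy,\qquad x\in\mathbb R^n, $$ where $B_n$ is the unit ball of $\mathbb R^n$ centered at the origin and $\mathrm dy$ is $d$-dimensional Lebesgue measure on $\sigma$, and let $\|\mathrm M_\Sigma\|_{L^p(\mathbb R^n)}$ be the least constant $C$ such that $\|\mathrm M_\Sigma f\|_p\le C\|f\|_p$ for all $f\in L^p(\mathbb R^n)$. Then there is a constant $c>0$, depending only on $d$ and $n$, such that for every integer $N\ge 1$ and every real $p>1$ $$ \sup_{\substack{\Sigma\subset\mathrm{Gr}(d,n)\\ \#\Sigma\le N}}\|\mathrm M_\Sigma\|_{L^p(\mathbb R^n)}\;\ge\; \begin{cases} c\,N^{\frac{n-d+1-p}{p(n-d)}}, & 1<p<n-d+1,\\[2pt] c\,(\log N)^{\frac1p}, & p\ge n-d+1. \end{cases}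 $$ -/

import Mathlib

open MeasureTheory
open scoped ENNReal

noncomputable section

/-- `Gr d n`: the Grassmannian of `d`-dimensional linear subspaces of `ℝⁿ`. -/
abbrev Gr (d n : ℕ) : Type :=
  {σ : Submodule ℝ (EuclideanSpace ℝ (Fin n)) // Module.finrank ℝ σ = d}

/-- The scale `s` average of `|f|` along the `d`-dimensional subspace `σ`,
`⟨|f|⟩_{s,σ}(x) = s⁻ᵈ ∫_{sB ∩ σ} |f (x - y)| dy`, where `dy` is the `d`-dimensional Lebesgue
measure on `σ` (the `volume` of the Euclidean space `σ`). Note the normalization by `sᵈ`. -/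
def subspaceAvg {d n : ℕ} (σ : Gr d n) (s : ℝ) (f : EuclideanSpace ℝ (Fin n) → ℝ)
    (x : EuclideanSpace ℝ (Fin n)) : ℝ≥0∞ :=
  (∫⁻ y : σ.1 in Metric.ball (0 : σ.1) s, ‖f (x - (y : EuclideanSpace ℝ (Fin n)))‖ₑ) /
    ENNReal.ofReal (s ^ d)

/-- The maximal averaging operator `M_{Σ,S}` over subspaces `σ ∈ Σ` and scales `s ∈ S`. -/
def maxAvg {d n : ℕ} (Sig : Set (Gr d n)) (S : Set ℝ) (f : EuclideanSpace ℝ (Fin n) → ℝ)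
    (x : EuclideanSpace ℝ (Fin n)) : ℝ≥0∞ :=
  ⨆ s ∈ S, ⨆ σ ∈ Sig, subspaceAvg σ s f x

/-- The single-scale operator `M_Σ = M_{Σ,{1}}`. -/
def singleScaleMaxAvg {d n : ℕ} (Sig : Set (Gr d n)) (f : EuclideanSpace ℝ (Fin n) → ℝ) :
    EuclideanSpace ℝ (Fin n) → ℝ≥0∞ :=
  maxAvg Sig {1} f

/-- The `Lᵖ(ℝⁿ) → Lᵖ(ℝⁿ)` operator norm of a (sublinear, nonnegative) operator `T`: the least
`C ∈ [0,∞]` with `‖T f‖_p ≤ C ‖f‖_p` for all `f ∈ Lᵖ(ℝⁿ)`. -/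
def lpOpNorm {n : ℕ}
    (T : (EuclideanSpace ℝ (Fin n) → ℝ) → EuclideanSpace ℝ (Fin n) → ℝ≥0∞) (p : ℝ≥0∞) : ℝ≥0∞ :=
  sInf {C : ℝ≥0∞ | ∀ f : EuclideanSpace ℝ (Fin n) → ℝ, MemLp f p volume →
    eLpNorm (T f) p volume ≤ C * eLpNorm f p volume}

/-- The supremum of `‖M_Σ‖_{Lᵖ(ℝⁿ)}` over all `Σ ⊂ Gr(d,n)` with `#Σ ≤ N`. -/
def supLpNorm (d n N : ℕ) (p : ℝ≥0∞) : ℝ≥0∞ :=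
  ⨆ (Sig : Finset (Gr d n)) (_ : Sig.card ≤ N),
    lpOpNorm (singleScaleMaxAvg (Sig : Set (Gr d n))) p

end

/-! Both bounds test the operator on an indicator: if some average of `1_E` is at least `κ` at every
point of `F`, the norm is at least `κ (|F|/|E|)^(1/p)` (`le_supLpNorm_of_le_subspaceAvg`). All
subspaces used are graphs over the first `d` coordinates that tilt only in the `d`-th one, so
averages can be bounded below in the parameter space `ℝᵈ`.

For small `p`, `E` is a slab of thickness about `δ = 1/M` in the last `n - d + 1` coordinates. The
`M^(n-d)` slopes of a `δ`-grid suffice for every point of a box `F` of size independent of `M` to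
see `E` with average about `δ`. This gives `M^((n-d+1)/p - 1)`, with `M` about `N^(1/(n-d))`
(`le_supLpNorm_of_pow_le`).

For large `p`, `E` is a planar Kakeya-type set times a box. It is built from `4^L` lines whose
slopes have `2L` binary digits, each digit with its own pivot. Over `[0, r]` the thickened lines
have vertical sections of size `O(r/L)` (`volume_pivotSection_le`), because near the `j`-th pivot
the later digits barely move a line. To the left of all pivots the lines spread out and come close
to every point (`exists_pivotLine_near`). Hence `κ` is bounded below and `|F|/|E|` is at least a
multiple of `L`, which is comparable to `log N`. -/

/-! ### Volumes of boxes, balls and linear preimages. -/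

/-- A half-open coordinate box in Euclidean space. -/
def euclideanBox {ι : Type*} (a b : ι → ℝ) : Set (EuclideanSpace ℝ ι) :=
  {x | ∀ i, x i ∈ Set.Ico (a i) (b i)}

lemma measurableSet_euclideanBox {ι : Type*} [Fintype ι] (a b : ι → ℝ) :
    MeasurableSet (euclideanBox a b) := by
  have : euclideanBox a b = WithLp.ofLp ⁻¹' (Set.univ.pi fun i => Set.Ico (a i) (b i)) := by
    ext x; simp [euclideanBox]
  rw [this]
  exact (PiLp.volume_preserving_ofLp ι).measurable
    (MeasurableSet.univ_pi fun i => measurableSet_Ico)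

lemma volume_euclideanBox {ι : Type*} [Fintype ι] (a b : ι → ℝ) :
    volume (euclideanBox a b) = ∏ i, ENNReal.ofReal (b i - a i) := by
  have : euclideanBox a b = WithLp.ofLp ⁻¹' (Set.univ.pi fun i => Set.Ico (a i) (b i)) := by
    ext x; simp [euclideanBox]
  rw [this, (PiLp.volume_preserving_ofLp ι).measure_preimage
    (MeasurableSet.univ_pi fun i => measurableSet_Ico).nullMeasurableSet, Real.volume_pi_Ico]

lemma volume_ball_eq_of_finrank_eq {E F : Type*} [NormedAddCommGroup E] [InnerProductSpace ℝ E]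
    [FiniteDimensional ℝ E] [MeasurableSpace E] [BorelSpace E] [NormedAddCommGroup F]
    [InnerProductSpace ℝ F] [FiniteDimensional ℝ F] [MeasurableSpace F] [BorelSpace F]
    (h : Module.finrank ℝ E = Module.finrank ℝ F) (r : ℝ) :
    volume (Metric.ball (0 : E) r) = volume (Metric.ball (0 : F) r) := by
  let g : E ≃ₗᵢ[ℝ] F := 
    (stdOrthonormalBasis ℝ E).equiv (stdOrthonormalBasis ℝ F) (finCongr h)
  rw [← g.measurePreserving.measure_preimage measurableSet_ball.nullMeasurableSet]
  congr 1
  ext x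
  simp

/-- A linear isomorphism that does not decrease norms does not decrease volumes. -/
lemma volume_preimage_le_of_norm_le {E F : Type*} [NormedAddCommGroup E] [InnerProductSpace ℝ E]
    [FiniteDimensional ℝ E] [MeasurableSpace E] [BorelSpace E] [NormedAddCommGroup F]
    [InnerProductSpace ℝ F] [FiniteDimensional ℝ F] [MeasurableSpace F] [BorelSpace F]
    (e : E ≃ₗ[ℝ] F) (he : ∀ x, ‖x‖ ≤ ‖e x‖) {B : Set F} (hB : MeasurableSet B) :
    volume (e ⁻¹' B) ≤ volume B := by
  let e' : E ≃L[ℝ] F := e.toContinuousLinearEquiv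
  have hmeas : Measurable e := e'.continuous.measurable
  have : (Measure.map e' (volume : Measure E)).IsAddHaarMeasure :=
    e'.isAddHaarMeasure_map volume
  have hsmul := Measure.isAddLeftInvariant_eq_smul (Measure.map e' (volume : Measure E))
    (volume : Measure F)
  set κ := Measure.addHaarScalarFactor (Measure.map e' (volume : Measure E)) (volume : Measure F)
  have key : ∀ s : Set F, MeasurableSet s → volume (e ⁻¹' s) = (κ : ℝ≥0∞) * volume s := by
    intro s hs
    have h1 : Measure.map e' (volume : Measure E) s = volume (e ⁻¹' s) :=
      Measure.map_apply hmeas hs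
    rw [← h1, hsmul]
    rfl
  have hpos : volume (Metric.ball (0 : F) 1) ≠ 0 :=
    (Metric.measure_ball_pos volume _ one_pos).ne'
  have hfin : volume (Metric.ball (0 : F) 1) ≠ ∞ := measure_ball_lt_top.ne
  -- The scaling factor is read off the unit ball: its preimage lies in the unit ball of `E`, which
  -- has the same volume.
  have hκ : (κ : ℝ≥0∞) ≤ 1 := by
    have h2 : volume (e ⁻¹' Metric.ball (0 : F) 1) ≤ volume (Metric.ball (0 : F) 1) := by
      rw [← volume_ball_eq_of_finrank_eq e.finrank_eq]
      refine measure_mono fun x hx => ?_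
      simp only [Set.mem_preimage, mem_ball_zero_iff] at hx ⊢
      exact (he x).trans_lt hx
    rw [key _ measurableSet_ball] at h2
    rwa [← ENNReal.mul_le_mul_iff_left hpos hfin, one_mul]
  rw [key B hB]
  exact mul_le_of_le_one_left' hκ

/-! ### Tilted subspaces and testing on indicators. -/

/-- The linear map `ℝᵈ → ℝⁿ` whose first `d` coordinates are the identity and whose `i`-th
coordinate for `i ≥ d` is `v i` times the last coordinate of the source. -/
noncomputable def slopeMap (d n : ℕ) (hd : 1 ≤ d) (v : Fin n → ℝ) :
    EuclideanSpace ℝ (Fin d) →ₗ[ℝ] EuclideanSpace ℝ (Fin n) where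
  toFun s := WithLp.toLp 2 fun i =>
    if h : (i : ℕ) < d then s ⟨i, h⟩ else v i * s ⟨d - 1, by omega⟩
  map_add' s t := by
    ext i
    by_cases h : (i : ℕ) < d
    · simp [h]
    · simp [h, mul_add]
  map_smul' c s := by
    ext i
    by_cases h : (i : ℕ) < d
    · simp [h]
    · simp [h]; ring

lemma slopeMap_apply (d n : ℕ) (hd : 1 ≤ d) (v : Fin n → ℝ) (s : EuclideanSpace ℝ (Fin d))
    (i : Fin n) : slopeMap d n hd v s i =
      if h : (i : ℕ) < d then s ⟨i, h⟩ else v i * s ⟨d - 1, by omega⟩ := rfl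

lemma norm_le_norm_slopeMap {d n : ℕ} (hd : 1 ≤ d) (hdn : d ≤ n) (v : Fin n → ℝ)
    (s : EuclideanSpace ℝ (Fin d)) : ‖s‖ ≤ ‖slopeMap d n hd v s‖ := by
  rw [← sq_le_sq₀ (norm_nonneg _) (norm_nonneg _), EuclideanSpace.norm_sq_eq,
    EuclideanSpace.norm_sq_eq]
  calc ∑ i, ‖s i‖ ^ 2 = ∑ i : Fin d, ‖slopeMap d n hd v s (Fin.castLE hdn i)‖ ^ 2 := by
        refine Finset.sum_congr rfl fun i _ => ?_
        rw [slopeMap_apply]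
        simp
    _ = ∑ i ∈ Finset.univ.map (Fin.castLEEmb hdn), ‖slopeMap d n hd v s i‖ ^ 2 := by
        rw [Finset.sum_map]; rfl
    _ ≤ ∑ i, ‖slopeMap d n hd v s i‖ ^ 2 :=
        Finset.sum_le_sum_of_subset_of_nonneg (Finset.subset_univ _) fun _ _ _ => by positivity

lemma slopeMap_injective {d n : ℕ} (hd : 1 ≤ d) (hdn : d ≤ n) (v : Fin n → ℝ) :
    Function.Injective (slopeMap d n hd v) := by
  rw [injective_iff_map_eq_zero]
  intro s hs
  have := norm_le_norm_slopeMap hd hdn v s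
  rw [hs, norm_zero] at this
  exact norm_le_zero_iff.mp this

/-- The `d`-dimensional subspace spanned by the first `d - 1` coordinate directions and a line
of slopes `v`. -/
noncomputable def slopeSubspace {d n : ℕ} (hd : 1 ≤ d) (hdn : d ≤ n) (v : Fin n → ℝ) : Gr d n :=
  ⟨LinearMap.range (slopeMap d n hd v), by
    rw [LinearMap.finrank_range_of_inj (slopeMap_injective hd hdn v), finrank_euclideanSpace_fin]⟩

/-- Parametrising the subspace by `slopeMap` does not decrease norms, so Lebesgue measure on the
subspace dominates that of the parameter space. No Jacobian needs to be computed. -/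
lemma volume_le_subspaceAvg_slopeSubspace {d n : ℕ} (hd : 1 ≤ d) (hdn : d ≤ n) (v : Fin n → ℝ)
    {E : Set (EuclideanSpace ℝ (Fin n))} (hE : MeasurableSet E) (x : EuclideanSpace ℝ (Fin n))
    {A : Set (EuclideanSpace ℝ (Fin d))}
    (hA : ∀ s ∈ A, ‖slopeMap d n hd v s‖ < 1 ∧ x - slopeMap d n hd v s ∈ E) :
    volume A ≤ subspaceAvg (slopeSubspace hd hdn v) 1 (E.indicator fun _ => (1 : ℝ)) x := by
  set σ := slopeSubspace hd hdn v with hσ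
  let e : EuclideanSpace ℝ (Fin d) ≃ₗ[ℝ] σ.1 :=
    LinearEquiv.ofInjective (slopeMap d n hd v) (slopeMap_injective hd hdn v)
  have he : ∀ s, ((e s : σ.1) : EuclideanSpace ℝ (Fin n)) = slopeMap d n hd v s := fun s => rfl
  let G : Set σ.1 := {y | x - (y : EuclideanSpace ℝ (Fin n)) ∈ E}
  have hG : MeasurableSet G := by
    have : Measurable fun y : σ.1 => x - (y : EuclideanSpace ℝ (Fin n)) :=
      (continuous_const.sub continuous_subtype_val).measurable
    exact this hE
  have hint : ∀ y : σ.1, ‖E.indicator (fun _ => (1 : ℝ)) (x - (y : EuclideanSpace ℝ (Fin n)))‖ₑ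
      = G.indicator (fun _ => (1 : ℝ≥0∞)) y := by
    intro y
    by_cases hy : x - (y : EuclideanSpace ℝ (Fin n)) ∈ E
    · rw [Set.indicator_of_mem hy, Set.indicator_of_mem (show y ∈ G from hy)]; simp
    · rw [Set.indicator_of_notMem hy, Set.indicator_of_notMem (show y ∉ G from hy)]; simp
  unfold subspaceAvg
  simp_rw [hint]
  rw [lintegral_indicator_const hG, one_mul, Measure.restrict_apply hG, one_pow,
    ENNReal.ofReal_one, div_one]
  refine le_trans (measure_mono fun s hs => ?_)
    (volume_preimage_le_of_norm_le e (fun s => norm_le_norm_slopeMap hd hdn v s)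
      (hG.inter measurableSet_ball))
  obtain ⟨h1, h2⟩ := hA s hs
  refine ⟨?_, ?_⟩
  · change x - ((e s : σ.1) : EuclideanSpace ℝ (Fin n)) ∈ E
    rw [he]; exact h2
  · rw [mem_ball_zero_iff]
    exact h1

lemma norm_lt_one_of_abs_le {n : ℕ} {r : ℝ} (hr : 0 ≤ r) (hrn : n * (3 * r) < 1)
    (y : EuclideanSpace ℝ (Fin n)) (hy : ∀ i, |y i| ≤ 3 * r) : ‖y‖ < 1 := by
  rw [← sq_lt_one_iff₀ (norm_nonneg _), EuclideanSpace.norm_sq_eq]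
  have h0 : (0 : ℝ) ≤ n * (3 * r) := by positivity
  have hnn : (n : ℝ) ≤ (n : ℝ) * n := by exact_mod_cast Nat.le_mul_self n
  calc ∑ i, ‖y i‖ ^ 2 ≤ ∑ _i : Fin n, (3 * r) ^ 2 := by
        refine Finset.sum_le_sum fun i _ => ?_
        rw [Real.norm_eq_abs]
        exact pow_le_pow_left₀ (abs_nonneg _) (hy i) 2
    _ = n * (3 * r) ^ 2 := by simp
    _ ≤ (n * n) * (3 * r) ^ 2 := mul_le_mul_of_nonneg_right hnn (by positivity)
    _ = (n * (3 * r)) ^ 2 := by ring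
    _ < 1 := pow_lt_one₀ h0 hrn two_ne_zero

/-- Testing the maximal operators on the indicator of a set. -/
lemma le_supLpNorm_of_le_subspaceAvg {d n N : ℕ} {ι : Type*} [Fintype ι] (σ : ι → Gr d n)
    (hcard : Fintype.card ι ≤ N) {E F : Set (EuclideanSpace ℝ (Fin n))} (hE : MeasurableSet E)
    (hF : MeasurableSet F) {κ e : ℝ≥0∞} (he : volume E ≤ e) (hetop : e ≠ ∞)
    (h : ∀ x ∈ F, ∃ i, κ ≤ subspaceAvg (σ i) 1 (E.indicator fun _ => (1 : ℝ)) x)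
    {p : ℝ} (hp : 0 < p) :
    κ * (volume F / e) ^ (1 / p) ≤ supLpNorm d n N (ENNReal.ofReal p) := by
  classical
  let Sig : Finset (Gr d n) := Finset.univ.image σ
  have hSig : Sig.card ≤ N := Finset.card_image_le.trans hcard
  refine le_trans ?_ (le_iSup₂ (f := fun (Sig : Finset (Gr d n)) (_ : Sig.card ≤ N) =>
    lpOpNorm (singleScaleMaxAvg (Sig : Set (Gr d n))) (ENNReal.ofReal p)) Sig hSig)
  refine le_sInf fun C hC => ?_
  have hp0 : ENNReal.ofReal p ≠ 0 := by simpa using hp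
  have hptop : ENNReal.ofReal p ≠ ∞ := ENNReal.ofReal_ne_top
  have hEtop : volume E ≠ ∞ := ne_top_of_le_ne_top hetop he
  have h1 := hC (E.indicator fun _ => (1 : ℝ))
    (memLp_indicator_const _ hE 1 (Or.inr hEtop))
  have h2 : eLpNorm (F.indicator fun _ => κ) (ENNReal.ofReal p) volume ≤
      eLpNorm (singleScaleMaxAvg (Sig : Set (Gr d n)) (E.indicator fun _ => (1 : ℝ)))
        (ENNReal.ofReal p) volume := by
    refine eLpNorm_mono_enorm fun x => ?_
    simp only [enorm_eq_self]
    by_cases hx : x ∈ F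
    · rw [Set.indicator_of_mem hx]
      obtain ⟨i, hi⟩ := h x hx
      refine hi.trans ?_
      unfold singleScaleMaxAvg maxAvg
      refine le_iSup₂_of_le 1 rfl ?_
      exact le_iSup₂_of_le (σ i) (by simp [Sig]) le_rfl
    · rw [Set.indicator_of_notMem hx]; exact zero_le
  have h3 := h2.trans h1
  rw [eLpNorm_indicator_const hF hp0 hptop, eLpNorm_indicator_const hE hp0 hptop,
    ENNReal.toReal_ofReal hp.le, enorm_eq_self, enorm_one, one_mul] at h3
  rw [ENNReal.div_rpow_of_nonneg _ _ (by positivity), ← mul_div_assoc]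
  refine ENNReal.div_le_of_le_mul (h3.trans ?_)
  gcongr

/-! ### The slab example. -/

lemma prod_ite_val_lt {n k : ℕ} (hk : k ≤ n) (δ : ℝ) :
    ∏ i : Fin n, (if (i : ℕ) < k then (1 : ℝ) else δ) = δ ^ (n - k) := by
  rw [Fin.prod_univ_eq_prod_range (fun i => if i < k then (1 : ℝ) else δ) n]
  obtain ⟨l, rfl⟩ := Nat.exists_eq_add_of_le hk
  rw [Finset.prod_range_add, Finset.prod_congr rfl (fun i hi => if_pos (Finset.mem_range.mp hi))]
  simp

/-- The lower bound from a slab that is thin in `n - d + 1` directions. -/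
lemma le_supLpNorm_of_pow_le {d n : ℕ} (hd : 1 ≤ d) (hdn : d < n) {r : ℝ} (hr : 0 < r)
    (hrn : n * (3 * r) < 1) {M N : ℕ} (hM : 1 ≤ M) (hMN : M ^ (n - d) ≤ N) {p : ℝ} (hp : 0 < p) :
    ENNReal.ofReal (r ^ d / M * ((M : ℝ) ^ (n - d + 1) / 6 ^ n) ^ (1 / p)) ≤
      supLpNorm d n N (ENNReal.ofReal p) := by
  have hM0 : (0 : ℝ) < M := by exact_mod_cast hM
  have hM1 : (1 : ℝ) ≤ M := by exact_mod_cast hM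
  set δ : ℝ := 1 / M with hδ
  have hδ0 : 0 < δ := by positivity
  have hMδ : M * δ = 1 := by rw [hδ]; field_simp
  have hδ1 : δ ≤ 1 := by rw [hδ, div_le_one hM0]; exact hM1
  let i₀ : Fin n := ⟨d - 1, by omega⟩
  let j₀ : Fin d := ⟨d - 1, by omega⟩
  let v : (Fin (n - d) → Fin M) → Fin n → ℝ := fun g i =>
    if h : d ≤ (i : ℕ) then ((g ⟨i - d, by omega⟩ : ℕ) : ℝ) * δ else 0
  let ρ : Fin n → ℝ := fun i => if (i : ℕ) < d - 1 then 1 else δ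
  -- On `F` the pivot coordinate lies in `[r, 2r)` and the others in `[0, r)`, so every required
  -- slope `x i / x i₀` lies in `[0, 1)`.
  let a : Fin n → ℝ := fun i => if i = i₀ then r else 0
  let E := euclideanBox (fun i => -(3 * r * ρ i)) (fun i => 3 * r * ρ i)
  let F := euclideanBox a (fun i => a i + r)
  have hvolF : volume F = ENNReal.ofReal (r ^ n) := by
    rw [volume_euclideanBox]
    simp [ENNReal.ofReal_pow hr.le]
  have hρ : ∀ i, 0 ≤ ρ i := fun i => by dsimp only [ρ]; split_ifs <;> positivity
  have hvolE : volume E = ENNReal.ofReal ((6 * r) ^ n * δ ^ (n - d + 1)) := by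
    rw [volume_euclideanBox, ← ENNReal.ofReal_prod_of_nonneg]
    · congr 1
      have : ∀ i, 3 * r * ρ i - -(3 * r * ρ i) = (6 * r) * ρ i := fun i => by ring
      simp_rw [this]
      rw [Finset.prod_mul_distrib, prod_ite_val_lt (by omega)]
      simp only [Finset.prod_const, Finset.card_univ, Fintype.card_fin]
      congr 2
      omega
    · intro i _
      have := mul_nonneg hr.le (hρ i)
      linarith
  have hmain := le_supLpNorm_of_le_subspaceAvg (N := N) (κ := ENNReal.ofReal (r ^ d * δ))
    (fun g => slopeSubspace hd hdn.le (v g))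
    (by simpa using hMN) (measurableSet_euclideanBox _ _ : MeasurableSet E)
    (measurableSet_euclideanBox _ _ : MeasurableSet F) hvolE.le ENNReal.ofReal_ne_top ?_ hp
  · refine le_trans (le_of_eq ?_) hmain
    rw [hvolF, ← ENNReal.ofReal_div_of_pos (by positivity),
      ENNReal.ofReal_rpow_of_nonneg (by positivity) (by positivity),
      ← ENNReal.ofReal_mul (by positivity)]
    congr 3
    · rw [hδ]; ring
    · rw [mul_pow, hδ, one_div, inv_pow]
      field_simp
  intro x hx
  have hxi : ∀ i, a i ≤ x i ∧ x i < a i + r := hx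
  have hx0 : r ≤ x i₀ ∧ x i₀ < r + r := by simpa [a] using hxi i₀
  have hx1 : ∀ i, i ≠ i₀ → 0 ≤ x i ∧ x i < r := fun i hi => by simpa [a, hi] using hxi i
  have ht : 0 < x i₀ := hr.trans_le hx0.1
  have hne : ∀ i : Fin n, d ≤ (i : ℕ) → i ≠ i₀ := by
    rintro i hi rfl
    simp only [i₀] at hi
    omega
  have hfloor : ∀ i : Fin n, d ≤ (i : ℕ) → ⌊M * (x i / x i₀)⌋₊ < M := by
    intro i hi
    have h := hx1 i (hne i hi)
    rw [Nat.floor_lt (by have := h.1; positivity)]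
    have : x i / x i₀ < 1 := by rw [div_lt_one ht]; linarith [hx0.1]
    nlinarith
  let g : Fin (n - d) → Fin M := fun k =>
    ⟨⌊M * (x ⟨d + k, by omega⟩ / x i₀)⌋₊, hfloor _ (by simp)⟩
  have hvg : ∀ i : Fin n, d ≤ (i : ℕ) → v g i = (⌊M * (x i / x i₀)⌋₊ : ℝ) * δ := by
    intro i hi
    simp only [v, hi, dif_pos, g, Nat.add_sub_of_le hi]
  -- Rounding the slope down to the grid costs less than `δ * x i₀`; the slab's half-width `3rδ`
  -- leaves a further `rδ` for moving `s j₀`.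
  have hv01 : ∀ i : Fin n, d ≤ (i : ℕ) → 0 ≤ v g i ∧ v g i ≤ 1 ∧ 0 ≤ x i - v g i * x i₀ ∧
      x i - v g i * x i₀ < δ * (2 * r) := by
    intro i hi
    have h := hx1 i (hne i hi)
    rw [hvg i hi]
    have hq : (0 : ℝ) ≤ M * (x i / x i₀) := by have := h.1; positivity
    have h1 := Nat.floor_le hq
    have h2 := Nat.lt_floor_add_one (M * (x i / x i₀))
    have h3 : ((⌊M * (x i / x i₀)⌋₊ : ℕ) : ℝ) < M := by exact_mod_cast hfloor i hi
    set q : ℝ := ((⌊M * (x i / x i₀)⌋₊ : ℕ) : ℝ)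
    have hxx : M * (x i / x i₀) * (δ * x i₀) = x i := by
      rw [hδ]; field_simp
    have hpos : 0 < δ * x i₀ := mul_pos hδ0 ht
    have h4 := mul_le_mul_of_nonneg_right h1 hpos.le
    have h5 := mul_lt_mul_of_pos_right h2 hpos
    rw [hxx] at h4 h5
    have h6 : δ * x i₀ ≤ δ * (2 * r) := mul_le_mul_of_nonneg_left (by linarith) hδ0.le
    refine ⟨mul_nonneg (Nat.cast_nonneg _) hδ0.le, ?_, by linarith, by linarith⟩
    rw [← hMδ]
    exact mul_le_mul_of_nonneg_right h3.le hδ0.le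
  refine ⟨g, ?_⟩
  -- Only parameters with `s j₀` within `rδ` of `x i₀` are kept; this produces the factor `δ` in the
  -- average.
  let b : Fin d → ℝ := fun i => if i = j₀ then x i₀ else 0
  let l : Fin d → ℝ := fun i => r * (if i = j₀ then δ else 1)
  have hvolA : volume (euclideanBox b (fun i => b i + l i)) = ENNReal.ofReal (r ^ d * δ) := by
    rw [volume_euclideanBox, ← ENNReal.ofReal_prod_of_nonneg]
    · congr 1
      simp only [add_sub_cancel_left, l, Finset.prod_mul_distrib, Finset.prod_ite_eq',
        Finset.prod_const, Finset.card_univ, Fintype.card_fin, Finset.mem_univ, if_true]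
    · intro i _
      simp only [add_sub_cancel_left, l]
      split_ifs <;> positivity
  rw [← hvolA]
  refine volume_le_subspaceAvg_slopeSubspace hd hdn.le (v g) (measurableSet_euclideanBox _ _) x ?_
  intro s hs
  have hsi : ∀ i, b i ≤ s i ∧ s i < b i + l i := hs
  have hs0 : x i₀ ≤ s j₀ ∧ s j₀ < x i₀ + r * δ := by simpa [b, l] using hsi j₀
  have hs1 : ∀ i, i ≠ j₀ → 0 ≤ s i ∧ s i < r := fun i hi => by simpa [b, l, hi] using hsi i
  have hrδ : r * δ ≤ r := mul_le_of_le_one_right hr.le hδ1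
  have hrδ0 : 0 < r * δ := mul_pos hr hδ0
  constructor
  · refine norm_lt_one_of_abs_le hr.le hrn _ fun i => ?_
    rw [slopeMap_apply]
    split_ifs with h
    · by_cases hi : (⟨i, h⟩ : Fin d) = j₀
      · rw [hi, abs_le]
        constructor <;> linarith
      · have := hs1 _ hi
        rw [abs_le]
        constructor <;> linarith
    · have h1 := hv01 i (not_lt.mp h)
      change |v g i * s j₀| ≤ 3 * r
      rw [abs_mul, abs_of_nonneg h1.1, abs_of_nonneg (by linarith)]
      calc v g i * s j₀ ≤ 1 * s j₀ := mul_le_mul_of_nonneg_right h1.2.1 (by linarith)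
        _ ≤ 3 * r := by linarith
  · intro i
    simp only [PiLp.sub_apply, Set.mem_Ico]
    rw [slopeMap_apply]
    split_ifs with h
    · by_cases hi : (⟨i, h⟩ : Fin d) = j₀
      · have hii : i = i₀ := Fin.ext (show (i : ℕ) = d - 1 from congrArg Fin.val hi)
        rw [hi, hii]
        have : ρ i₀ = δ := by simp [ρ, i₀]
        rw [this]
        constructor <;> linarith
      · have h1 := hs1 _ hi
        have hii : i ≠ i₀ := fun h' => hi (Fin.ext (show (i : ℕ) = d - 1 from congrArg Fin.val h'))
        have h2 := hx1 i hii
        have h3 : (i : ℕ) ≠ d - 1 := fun h' => hii (Fin.ext h')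
        have : ρ i = 1 := by
          simp only [ρ]
          rw [if_pos (by omega)]
        rw [this]
        constructor <;> linarith
    · have h1 := hv01 i (not_lt.mp h)
      have : ρ i = δ := by
        simp only [ρ]
        rw [if_neg (by omega)]
      rw [this]
      change _ ≤ x i - v g i * s j₀ ∧ x i - v g i * s j₀ < _
      have h2 : 0 ≤ v g i * (s j₀ - x i₀) := mul_nonneg h1.1 (by linarith)
      have h3 : v g i * (s j₀ - x i₀) ≤ 1 * (s j₀ - x i₀) :=
        mul_le_mul_of_nonneg_right h1.2.1 (by linarith)
      constructor <;> nlinarith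

/-! ### Pivoted lines and their vertical sections. -/

/-- The affine function whose graph is the line of the Kakeya-type set with digit set `S`: its
slope has the binary digits `S`, and the `k`-th digit is pivoted at the abscissa `k * h`. -/
noncomputable def pivotLine (h : ℝ) (S : Finset ℕ) (t : ℝ) : ℝ :=
  ∑ k ∈ S, (1 / 2 : ℝ) ^ (k + 1) * (t - k * h)

lemma pivotLine_sub (h : ℝ) (S : Finset ℕ) (t s : ℝ) :
    pivotLine h S (t - s) = pivotLine h S t - (∑ k ∈ S, (1 / 2 : ℝ) ^ (k + 1)) * s := by
  unfold pivotLine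
  rw [Finset.sum_mul, ← Finset.sum_sub_distrib]
  exact Finset.sum_congr rfl fun k _ => by ring

lemma sum_half_pow_le_one {K : ℕ} {S : Finset ℕ} (hS : S ⊆ Finset.range K) :
    ∑ k ∈ S, (1 / 2 : ℝ) ^ (k + 1) ≤ 1 := by
  have h : ∀ K : ℕ, ∑ k ∈ Finset.range K, (1 / 2 : ℝ) ^ (k + 1) = 1 - (1 / 2) ^ K := by
    intro K
    induction K with
    | zero => simp
    | succ K ih => rw [Finset.sum_range_succ, ih]; ring
  calc _ ≤ ∑ k ∈ Finset.range K, (1 / 2 : ℝ) ^ (k + 1) :=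
        Finset.sum_le_sum_of_subset_of_nonneg hS fun _ _ _ => by positivity
    _ ≤ 1 := by rw [h]; have : (0 : ℝ) ≤ (1 / 2) ^ K := by positivity
                linarith

/-- Greedy expansion: to the left of the pivots the lines come close to every point. -/
lemma exists_pivotLine_near {u h : ℝ} (hh : 0 ≤ h) {y : ℝ} (hy0 : 0 ≤ y) (hyu : y ≤ u)
    (K : ℕ) : ∃ S ⊆ Finset.range K, 0 ≤ y + pivotLine h S (-u) ∧
      y + pivotLine h S (-u) ≤ (1 / 2) ^ K * (u + K * h) := by
  induction K with
  | zero => exact ⟨∅, by simp, by simpa [pivotLine] using hy0, by simpa [pivotLine] using hyu⟩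
  | succ K ih =>
    obtain ⟨S, hS, h0, h1⟩ := ih
    have hnot : K ∉ S := fun hK => by simpa using hS hK
    have hpow : (0 : ℝ) < (1 / 2) ^ K := by positivity
    have hstep : (1 / 2 : ℝ) ^ (K + 1) * (u + K * h) ≤
        (1 / 2 : ℝ) ^ (K + 1) * (u + (K + 1 : ℕ) * h) := by
      refine mul_le_mul_of_nonneg_left ?_ (by positivity)
      push_cast
      nlinarith
    have hhalf : (1 / 2 : ℝ) ^ K * (u + K * h) = 2 * ((1 / 2 : ℝ) ^ (K + 1) * (u + K * h)) := by
      ring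
    -- Digit `K` lowers the value at `-u` by half the current bound; it is taken exactly when the
    -- result stays nonnegative.
    by_cases hcase : (1 / 2 : ℝ) ^ (K + 1) * (u + K * h) ≤ y + pivotLine h S (-u)
    · refine ⟨insert K S, ?_, ?_⟩
      · intro k hk
        rcases Finset.mem_insert.mp hk with rfl | hk
        · simp
        · exact Finset.mem_range.mpr ((Finset.mem_range.mp (hS hk)).trans (Nat.lt_succ_self K))
      · have : pivotLine h (insert K S) (-u) =
            pivotLine h S (-u) - (1 / 2 : ℝ) ^ (K + 1) * (u + K * h) := by
          unfold pivotLine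
          rw [Finset.sum_insert hnot]
          ring
        rw [this]
        constructor <;> linarith
    · refine ⟨S, fun k hk => ?_, h0, ?_⟩
      · exact Finset.mem_range.mpr ((Finset.mem_range.mp (hS hk)).trans (Nat.lt_succ_self K))
      · linarith [not_le.mp hcase]

lemma sum_range_half_pow_mul (q : ℕ) :
    ∑ i ∈ Finset.range q, (1 / 2 : ℝ) ^ (i + 1) * (i + 1) = 2 - (q + 2) * (1 / 2) ^ q := by
  induction q with
  | zero => simp
  | succ q ih => rw [Finset.sum_range_succ, ih]; push_cast; ring

/-- Near the `j`-th pivot a line is determined, up to a small error, by its first `j` digits. -/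
lemma abs_pivotLine_sub_le {h t : ℝ} (hh : 0 ≤ h) {j K : ℕ} (hj0 : j * h ≤ t)
    (hj1 : t ≤ (j + 1) * h) {S : Finset ℕ} (hS : S ⊆ Finset.range K) :
    |pivotLine h S t - pivotLine h (S.filter (· < j)) t| ≤ 2 * (1 / 2) ^ j * h := by
  have h1 : pivotLine h S t - pivotLine h (S.filter (· < j)) t =
      ∑ k ∈ S.filter (fun k => ¬ k < j), (1 / 2 : ℝ) ^ (k + 1) * (t - k * h) := by
    unfold pivotLine
    rw [← Finset.sum_filter_add_sum_filter_not S (· < j)]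
    ring
  rw [h1]
  refine (Finset.abs_sum_le_sum_abs _ _).trans ?_
  calc ∑ k ∈ S.filter (fun k => ¬ k < j), |(1 / 2 : ℝ) ^ (k + 1) * (t - k * h)|
      ≤ ∑ k ∈ S.filter (fun k => ¬ k < j), (1 / 2 : ℝ) ^ (k + 1) * ((k - j + 1) * h) := by
        refine Finset.sum_le_sum fun k hk => ?_
        have hjk : (j : ℝ) ≤ k := by exact_mod_cast not_lt.mp (Finset.mem_filter.mp hk).2
        rw [abs_mul, abs_of_nonneg (by positivity)]
        refine mul_le_mul_of_nonneg_left ?_ (by positivity)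
        rw [abs_le]
        constructor <;> nlinarith
    -- The range is enlarged so that the shift by `j` gives a partial sum of `∑ (i + 1) / 2^(i+1) =
    -- 2`.
    _ ≤ ∑ k ∈ Finset.Ico j (j + K), (1 / 2 : ℝ) ^ (k + 1) * ((k - j + 1) * h) := by
        refine Finset.sum_le_sum_of_subset_of_nonneg (fun k hk => ?_) fun k hk _ => ?_
        · have h2 := Finset.mem_filter.mp hk
          have h3 := Finset.mem_range.mp (hS h2.1)
          exact Finset.mem_Ico.mpr ⟨not_lt.mp h2.2, by omega⟩
        · have hjk : (j : ℝ) ≤ k := by exact_mod_cast (Finset.mem_Ico.mp hk).1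
          have : (0 : ℝ) ≤ k - j + 1 := by linarith
          positivity
    _ = (1 / 2) ^ j * h * ∑ i ∈ Finset.range K, (1 / 2 : ℝ) ^ (i + 1) * (i + 1) := by
        rw [Finset.sum_Ico_eq_sum_range, Finset.mul_sum, add_tsub_cancel_left]
        refine Finset.sum_congr rfl fun i _ => ?_
        push_cast
        ring
    _ ≤ (1 / 2) ^ j * h * 2 := by
        refine mul_le_mul_of_nonneg_left ?_ (by positivity)
        rw [sum_range_half_pow_mul]
        have : (0 : ℝ) ≤ (K + 2) * (1 / 2) ^ K := by positivity
        linarith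
    _ = _ := by ring

/-- The vertical section at `t` of the `δ`-neighbourhood of the lines. -/
def pivotSection (h δ : ℝ) (K : ℕ) (t : ℝ) : Set ℝ :=
  {w | ∃ S ∈ (Finset.range K).powerset, |w - pivotLine h S t| ≤ δ}

/-- Grouping lines by their first `j` digits covers the section by `2^j` intervals of radius `2 *
2^(-j) * h + δ`. -/
lemma volume_pivotSection_le_of_mem {h δ t : ℝ} (hh : 0 ≤ h) {j K : ℕ} (hj0 : j * h ≤ t)
    (hj1 : t ≤ (j + 1) * h) :
    volume (pivotSection h δ K t) ≤ ENNReal.ofReal (4 * h + 2 ^ (j + 1) * δ) := by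
  have hsub : pivotSection h δ K t ⊆ ⋃ H ∈ (Finset.range j).powerset,
      Metric.closedBall (pivotLine h H t) (2 * (1 / 2) ^ j * h + δ) := by
    rintro w ⟨S, hS, hw⟩
    have hS' := Finset.mem_powerset.mp hS
    refine Set.mem_biUnion (x := S.filter (· < j)) ?_ ?_
    · simp only [Finset.coe_powerset, Set.mem_preimage, Set.mem_powerset_iff, Finset.coe_subset]
      intro k hk
      exact Finset.mem_range.mpr (Finset.mem_filter.mp hk).2
    · rw [Metric.mem_closedBall, Real.dist_eq]
      have := abs_pivotLine_sub_le hh hj0 hj1 hS'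
      calc _ ≤ |w - pivotLine h S t| + |pivotLine h S t - pivotLine h (S.filter (· < j)) t| :=
            abs_sub_le _ _ _
        _ ≤ _ := by linarith
  refine (measure_mono hsub).trans ((measure_biUnion_finset_le _ _).trans ?_)
  simp only [Real.volume_closedBall, Finset.sum_const, Finset.card_powerset, Finset.card_range,
    nsmul_eq_mul]
  rw [← ENNReal.ofReal_natCast, ← ENNReal.ofReal_mul (by positivity)]
  refine ENNReal.ofReal_le_ofReal (le_of_eq ?_)
  have : (2 : ℝ) ^ j * (1 / 2) ^ j = 1 := by rw [← mul_pow]; norm_num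
  push_cast
  linear_combination 4 * h * this

/-- Over `[0, r]` only `j ≤ L` occurs, while `2L` digits make `δ` of order `4^(-L)`. The `2^(j+1)`
copies of `δ` therefore add up to at most `8r / 2^L`, below the main term's order `r / L`. -/
lemma volume_pivotSection_le {r t : ℝ} (hr : 0 < r) {L : ℕ} (hL : 1 ≤ L) (ht0 : 0 ≤ t)
    (htr : t ≤ r) : volume (pivotSection (r / L) (4 * r * (1 / 4) ^ L) (2 * L) t) ≤
      ENNReal.ofReal (12 * r / L) := by
  have hL0 : (0 : ℝ) < L := by exact_mod_cast hL
  set h := r / L with hh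
  have hh0 : 0 < h := by positivity
  set j := ⌊t / h⌋₊ with hj
  have h1 : j * h ≤ t := (le_div_iff₀ hh0).mp (Nat.floor_le (by positivity))
  have h2 : t ≤ (j + 1) * h := (div_le_iff₀ hh0).mp (Nat.lt_floor_add_one _).le
  have hjL : j ≤ L := by
    refine Nat.floor_le_of_le ?_
    rw [div_le_iff₀ hh0, hh]
    field_simp
    exact htr
  refine (volume_pivotSection_le_of_mem hh0.le h1 h2).trans (ENNReal.ofReal_le_ofReal ?_)
  have h3 : (2 : ℝ) ^ (j + 1) ≤ 2 ^ (L + 1) := pow_le_pow_right₀ (by norm_num) (by omega)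
  have h4 : (L : ℝ) ≤ 2 ^ L := by exact_mod_cast (Nat.lt_two_pow_self (n := L)).le
  have h5 : (2 : ℝ) ^ (L + 1) * (4 * r * (1 / 4) ^ L) = 8 * r / 2 ^ L := by
    have : (1 / 4 : ℝ) ^ L = 1 / 2 ^ L * (1 / 2 ^ L) := by
      rw [div_mul_div_comm, ← mul_pow, one_div_pow]; norm_num
    rw [this, pow_succ]
    field_simp
    ring
  calc 4 * h + 2 ^ (j + 1) * (4 * r * (1 / 4) ^ L)
      ≤ 4 * h + 2 ^ (L + 1) * (4 * r * (1 / 4) ^ L) := by gcongr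
    _ = 4 * r / L + 8 * r / 2 ^ L := by rw [h5, hh]; ring
    _ ≤ 4 * r / L + 8 * r / L := by gcongr
    _ = 12 * r / L := by ring

/-! ### The Kakeya example. -/

/-- A Fubini estimate: a set of bounded width in all coordinates and small sections. -/
lemma volume_le_of_section_le {n : ℕ} {i₀ i₁ : Fin (n + 1)} (hi : i₁ ≠ i₀) {r : ℝ}
    {W : ℝ → Set ℝ} {B : ℝ≥0∞} (hW : ∀ t ∈ Set.Icc 0 r, volume (W t) ≤ B)
    {E : Set (EuclideanSpace ℝ (Fin (n + 1)))} (hEm : MeasurableSet E)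
    (hE : ∀ y ∈ E, y i₀ ∈ Set.Icc 0 r ∧ y i₁ ∈ W (y i₀) ∧
      ∀ i, i ≠ i₀ → i ≠ i₁ → y i ∈ Set.Icc (-r) r) :
    volume E ≤ B * ENNReal.ofReal (2 * r) ^ (n - 1) * ENNReal.ofReal r := by
  let Φ := (MeasurableEquiv.piFinSuccAbove (fun _ : Fin (n + 1) => ℝ) i₀).symm
  have hΦ : MeasurePreserving Φ volume volume :=
    (volume_preserving_piFinSuccAbove (fun _ : Fin (n + 1) => ℝ) i₀).symm
  have hΨ := (PiLp.volume_preserving_toLp (Fin (n + 1))).comp hΦ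
  rw [← hΨ.measure_preimage hEm.nullMeasurableSet]
  have hm : MeasurableSet ((@WithLp.toLp 2 (Fin (n + 1) → ℝ)) ∘ Φ ⁻¹' E) := hΨ.measurable hEm
  obtain ⟨k₁, hk₁⟩ := Fin.exists_succAbove_eq hi
  have hcoord0 : ∀ t (z : Fin n → ℝ), Φ (t, z) i₀ = t := fun t z =>
    Fin.insertNth_apply_same (α := fun _ => ℝ) i₀ t z
  have hcoord : ∀ t (z : Fin n → ℝ) k, Φ (t, z) (i₀.succAbove k) = z k := fun t z k =>
    Fin.insertNth_apply_succAbove (α := fun _ => ℝ) i₀ t z k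
  rw [Measure.volume_eq_prod, Measure.prod_apply hm]
  calc _ ≤ ∫⁻ t, (Set.Icc 0 r).indicator
        (fun _ => B * ENNReal.ofReal (2 * r) ^ (n - 1)) t := by
        refine lintegral_mono fun t => ?_
        by_cases ht : t ∈ Set.Icc 0 r
        · rw [Set.indicator_of_mem ht]
          let G : Fin n → Set ℝ := fun k => if k = k₁ then W t else Set.Icc (-r) r
          have hsub : Prod.mk t ⁻¹' ((@WithLp.toLp 2 (Fin (n + 1) → ℝ)) ∘ Φ ⁻¹' E) ⊆
              Set.univ.pi G := by
            intro z hz k _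
            obtain ⟨_, h1, h2⟩ := hE _ hz
            simp only [Function.comp_apply] at h1 h2
            by_cases hk : k = k₁
            · rw [hk]
              rw [← hk₁, hcoord, hcoord0] at h1
              simpa [G] using h1
            · have := h2 (i₀.succAbove k) (Fin.succAbove_ne _ _) (by
                rw [← hk₁]; exact fun h => hk (Fin.succAbove_right_injective h))
              rw [hcoord] at this
              simpa [G, hk] using this
          refine (measure_mono hsub).trans ?_
          rw [volume_pi, Measure.pi_pi, ← Finset.mul_prod_erase _ _ (Finset.mem_univ k₁)]
          refine mul_le_mul' (by simpa [G] using hW t ht) (le_of_eq ?_)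
          rw [Finset.prod_congr rfl (g := fun _ => ENNReal.ofReal (2 * r))]
          · simp
          · intro k hk
            simp only [G, if_neg (Finset.ne_of_mem_erase hk), Real.volume_Icc]
            congr 1
            ring
        · rw [Set.indicator_of_notMem ht]
          refine le_of_eq ?_
          convert measure_empty (μ := volume)
          ext z
          simp only [Set.mem_preimage, Function.comp_apply, Set.mem_empty_iff_false, iff_false]
          intro hz
          have : Φ (t, z) i₀ ∈ Set.Icc 0 r := (hE _ hz).1
          rw [hcoord0] at this
          exact ht this
    _ = _ := by
        rw [lintegral_indicator_const measurableSet_Icc, Real.volume_Icc, sub_zero]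

/-- The lower bound from a Kakeya-type set. -/
lemma le_supLpNorm_of_two_pow_le {d n : ℕ} (hd : 1 ≤ d) (hdn : d < n) {r : ℝ} (hr : 0 < r)
    (hrn : n * (3 * r) < 1) {L N : ℕ} (hL : 1 ≤ L) (hLN : 2 ^ (2 * L) ≤ N) {p : ℝ} (hp : 0 < p) :
    ENNReal.ofReal (r ^ d * (L / (12 * 2 ^ (n - 2))) ^ (1 / p)) ≤
      supLpNorm d n N (ENNReal.ofReal p) := by
  have hL0 : (0 : ℝ) < L := by exact_mod_cast hL
  let i₀ : Fin n := ⟨d - 1, by omega⟩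
  let i₁ : Fin n := ⟨d, hdn⟩
  let j₀ : Fin d := ⟨d - 1, by omega⟩
  have hi : i₁ ≠ i₀ := fun h => by
    have := congrArg Fin.val h
    simp only [i₀, i₁] at this
    omega
  set h : ℝ := r / L with hh
  have hh0 : 0 ≤ h := by positivity
  set δ : ℝ := 4 * r * (1 / 4) ^ L with hδ
  let slope : Finset ℕ → ℝ := fun S => ∑ k ∈ S, (1 / 2 : ℝ) ^ (k + 1)
  let v : (Finset.range (2 * L)).powerset → Fin n → ℝ := fun S i =>
    if i = i₁ then slope S else 0
  let a : Fin n → ℝ := fun i => if i = i₀ then -(2 * r) else if i = i₁ then -r else 0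
  let F := euclideanBox a (fun i => a i + r)
  let E : Set (EuclideanSpace ℝ (Fin n)) := {y | y i₀ ∈ Set.Icc 0 r ∧
    y i₁ ∈ pivotSection h δ (2 * L) (y i₀) ∧ ∀ i, i ≠ i₀ → i ≠ i₁ → y i ∈ Set.Icc (-r) r}
  have hvolF : volume F = ENNReal.ofReal (r ^ n) := by
    rw [volume_euclideanBox]
    simp [ENNReal.ofReal_pow hr.le]
  have hcoord : ∀ i, Measurable fun y : EuclideanSpace ℝ (Fin n) => y i := fun i => by fun_prop
  have hEm : MeasurableSet E := by
    refine (hcoord i₀ measurableSet_Icc).inter (MeasurableSet.inter ?_ ?_)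
    · have : {y : EuclideanSpace ℝ (Fin n) | y i₁ ∈ pivotSection h δ (2 * L) (y i₀)} =
          ⋃ S ∈ (Finset.range (2 * L)).powerset, {y | |y i₁ - pivotLine h S (y i₀)| ≤ δ} := by
        ext y
        simp only [pivotSection, Set.mem_ofPred_eq, Set.mem_iUnion, exists_prop]
      change MeasurableSet {y : EuclideanSpace ℝ (Fin n) |
        y i₁ ∈ pivotSection h δ (2 * L) (y i₀)}
      rw [this]
      refine Finset.measurableSet_biUnion _ fun S _ => ?_
      refine (isClosed_le ?_ continuous_const).measurableSet
      unfold pivotLine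
      fun_prop
    · have : {y : EuclideanSpace ℝ (Fin n) | ∀ i, i ≠ i₀ → i ≠ i₁ → y i ∈ Set.Icc (-r) r} =
          ⋂ (i : Fin n) (_ : i ≠ i₀) (_ : i ≠ i₁), (fun y => y i) ⁻¹' Set.Icc (-r) r := by
        ext y
        simp
      change MeasurableSet {y : EuclideanSpace ℝ (Fin n) |
        ∀ i, i ≠ i₀ → i ≠ i₁ → y i ∈ Set.Icc (-r) r}
      rw [this]
      exact MeasurableSet.iInter fun i => MeasurableSet.iInter fun _ =>
        MeasurableSet.iInter fun _ => hcoord i measurableSet_Icc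
  have hvolE : volume E ≤ ENNReal.ofReal (12 * r / L * (2 * r) ^ (n - 2) * r) := by
    obtain ⟨k, rfl⟩ : ∃ k, n = k + 1 := ⟨n - 1, by omega⟩
    refine (volume_le_of_section_le hi (B := ENNReal.ofReal (12 * r / L))
      (fun t ht => volume_pivotSection_le hr hL ht.1 ht.2) hEm fun y hy => hy).trans (le_of_eq ?_)
    rw [← ENNReal.ofReal_pow (by positivity), ← ENNReal.ofReal_mul (by positivity),
      ← ENNReal.ofReal_mul (by positivity)]
    rfl
  have hmain := le_supLpNorm_of_le_subspaceAvg (N := N) (κ := ENNReal.ofReal (r ^ d))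
    (fun S => slopeSubspace hd hdn.le (v S))
    (by simpa using hLN) hEm
    (measurableSet_euclideanBox _ _ : MeasurableSet F) hvolE ENNReal.ofReal_ne_top ?_ hp
  · refine le_trans (le_of_eq ?_) hmain
    rw [hvolF, ← ENNReal.ofReal_div_of_pos (by positivity),
      ENNReal.ofReal_rpow_of_nonneg (by positivity) (by positivity),
      ← ENNReal.ofReal_mul (by positivity)]
    congr 3
    obtain ⟨k, rfl⟩ : ∃ k, n = k + 2 := ⟨n - 2, by omega⟩
    rw [Nat.add_sub_cancel, mul_pow]
    field_simp
    ring
  intro x hx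
  have hxi : ∀ i, a i ≤ x i ∧ x i < a i + r := hx
  have hx0 : -(2 * r) ≤ x i₀ ∧ x i₀ < -(2 * r) + r := by simpa [a] using hxi i₀
  have hx1 : -r ≤ x i₁ ∧ x i₁ < -r + r := by
    have h1 := hxi i₁
    simp only [a, if_neg hi, if_true] at h1
    exact h1
  have hx2 : ∀ i, i ≠ i₀ → i ≠ i₁ → 0 ≤ x i ∧ x i < r := fun i hi hi' => by
    simpa [a, hi, hi'] using hxi i
  -- The choice of `F` gives `-x i₁ ≤ r ≤ -x i₀ ≤ 2r`. The error is then at most `4^(-L) * (2r + 2L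
  -- * h)`, which is `δ`.
  obtain ⟨S, hS, hS0, hS1⟩ := exists_pivotLine_near (u := -x i₀) (y := -x i₁) hh0
    (by linarith) (by linarith) (2 * L)
  rw [neg_neg] at hS0 hS1
  have hSδ : -x i₁ + pivotLine h S (x i₀) ≤ δ := by
    refine hS1.trans ?_
    have h1 : ((2 * L : ℕ) : ℝ) * h = 2 * r := by rw [hh]; push_cast; field_simp
    rw [h1, hδ, pow_mul, mul_comm]
    have h2 : ((1 / 2 : ℝ) ^ 2) = 1 / 4 := by norm_num
    rw [h2]
    exact mul_le_mul_of_nonneg_right (by linarith) (by positivity)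
  have hslope0 : 0 ≤ slope S := Finset.sum_nonneg fun _ _ => by positivity
  have hslope1 : slope S ≤ 1 := sum_half_pow_le_one hS
  refine ⟨⟨S, Finset.mem_powerset.mpr hS⟩, ?_⟩
  -- These parameters carry the abscissa `x i₀ - s j₀` into `(0, r]`, where the sections are small.
  -- Moving parallel to line `S` preserves the vertical error.
  let b : Fin d → ℝ := fun i => if i = j₀ then x i₀ - r else 0
  have hvolA : volume (euclideanBox b (fun i => b i + r)) = ENNReal.ofReal (r ^ d) := by
    rw [volume_euclideanBox]
    simp [ENNReal.ofReal_pow hr.le]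
  rw [← hvolA]
  refine volume_le_subspaceAvg_slopeSubspace hd hdn.le _ hEm x ?_
  intro s hs
  have hsi : ∀ i, b i ≤ s i ∧ s i < b i + r := hs
  have hs0 : x i₀ - r ≤ s j₀ ∧ s j₀ < x i₀ := by simpa [b] using hsi j₀
  have hs1 : ∀ i, i ≠ j₀ → 0 ≤ s i ∧ s i < r := fun i hi => by simpa [b, hi] using hsi i
  set vS := v ⟨S, Finset.mem_powerset.mpr hS⟩ with hvS
  have hv1 : vS i₁ = slope S := by simp [hvS, v]
  have hv2 : ∀ i, i ≠ i₁ → vS i = 0 := fun i hi => by simp [hvS, v, hi]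
  have hm0 : slopeMap d n hd vS s i₀ = s j₀ := by
    rw [slopeMap_apply, dif_pos (show (i₀ : ℕ) < d by simp only [i₀]; omega)]
  have hm1 : slopeMap d n hd vS s i₁ = slope S * s j₀ := by
    rw [slopeMap_apply, dif_neg (show ¬ (i₁ : ℕ) < d by simp only [i₁]; omega), hv1]
  have hm2 : ∀ i, i ≠ i₀ → i ≠ i₁ →
      0 ≤ slopeMap d n hd vS s i ∧ slopeMap d n hd vS s i ≤ r := by
    intro i hi hi'
    rw [slopeMap_apply]
    split_ifs with h
    · have hij : (⟨i, h⟩ : Fin d) ≠ j₀ := fun h' =>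
        hi (Fin.ext (show (i : ℕ) = d - 1 from congrArg Fin.val h'))
      exact ⟨(hs1 _ hij).1, (hs1 _ hij).2.le⟩
    · rw [hv2 i hi', zero_mul]
      exact ⟨le_rfl, hr.le⟩
  constructor
  · refine norm_lt_one_of_abs_le hr.le hrn _ fun i => ?_
    by_cases hi0 : i = i₀
    · rw [hi0, hm0, abs_le]
      constructor <;> linarith
    by_cases hi1 : i = i₁
    · rw [hi1, hm1, abs_mul, abs_of_nonneg hslope0]
      calc slope S * |s j₀| ≤ 1 * |s j₀| := mul_le_mul_of_nonneg_right hslope1 (abs_nonneg _)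
        _ ≤ 3 * r := by
            rw [one_mul, abs_le]
            constructor <;> linarith
    · have := hm2 i hi0 hi1
      rw [abs_le]
      constructor <;> linarith
  · refine ⟨?_, ⟨S, Finset.mem_powerset.mpr hS, ?_⟩, fun i hi0 hi1 => ?_⟩
    · rw [PiLp.sub_apply, hm0]
      constructor <;> linarith
    · rw [PiLp.sub_apply, PiLp.sub_apply, hm0, hm1, pivotLine_sub, abs_le]
      constructor <;> simp only [slope] <;> linarith
    · have h1 := hm2 i hi0 hi1
      have h2 := hx2 i hi0 hi1
      rw [PiLp.sub_apply]
      constructor <;> linarith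

/-! ### Choice of parameters, with constants uniform in `p`. -/

/-- Since `a ^ (1 / p) ≤ a`, dimensional constants leave the `p`-th root at a cost independent of
`p`. -/
lemma rpow_div_le_div_rpow {y a p : ℝ} (hy : 0 ≤ y) (ha : 1 ≤ a) (hp : 1 ≤ p) :
    y ^ (1 / p) / a ≤ (y / a) ^ (1 / p) := by
  have ha0 : 0 < a := one_pos.trans_le ha
  rw [Real.div_rpow hy ha0.le]
  have h1 : a ^ (1 / p) ≤ a := by
    conv_rhs => rw [← Real.rpow_one a]
    exact Real.rpow_le_rpow_of_exponent_le ha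
      (by rw [div_le_one (by linarith)]; exact hp)
  exact div_le_div_of_nonneg_left (Real.rpow_nonneg hy _) (Real.rpow_pos_of_pos ha0 _) h1

theorem proposition5p3 (n d : ℕ) (hd : 1 ≤ d) (hdn : d < n) :
    ∃ c : ℝ, 0 < c ∧ ∀ N : ℕ, 1 ≤ N → ∀ p : ℝ,
      (1 < p → p < (n : ℝ) - d + 1 →
        ENNReal.ofReal (c * (N : ℝ) ^ (((n : ℝ) - d + 1 - p) / (p * ((n : ℝ) - d)))) ≤
          supLpNorm d n N (ENNReal.ofReal p)) ∧
      ((n : ℝ) - d + 1 ≤ p →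
        ENNReal.ofReal (c * (Real.log (N : ℝ)) ^ (1 / p)) ≤
          supLpNorm d n N (ENNReal.ofReal p)) := by
  have hn0 : (0 : ℝ) < n := by exact_mod_cast (by omega : 0 < n)
  obtain ⟨r, hr, hrn⟩ : ∃ r : ℝ, 0 < r ∧ n * (3 * r) < 1 := by
    refine ⟨1 / (4 * n), by positivity, ?_⟩
    field_simp
    norm_num
  have hrd : 0 < r ^ d := pow_pos hr d
  have hm : ((n - d : ℕ) : ℝ) = n - d := Nat.cast_sub hdn.le
  have hm1 : (1 : ℝ) ≤ n - d := by rw [← hm]; exact_mod_cast (by omega : 1 ≤ n - d)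
  -- The slab needs `12^n = 2^n * 6^n` (rounding `M`, slab volume). The Kakeya set needs `48 = 4 *
  -- 12` (from `log N ≤ 4L` and the section bound), and there `12^n` absorbs `2^(n-2)`.
  refine ⟨r ^ d / (48 * 12 ^ n), by positivity, fun N hN p => ⟨fun hp1 hp2 => ?_, fun hp => ?_⟩⟩
  · have hp0 : 0 < p := by linarith
    have hN1 : (1 : ℝ) ≤ N := by exact_mod_cast hN
    set m : ℝ := (n : ℝ) - d with hmdef
    have hm0 : 0 < m := by linarith
    set R : ℝ := (N : ℝ) ^ (1 / m) with hR
    have hR1 : 1 ≤ R := Real.one_le_rpow hN1 (by positivity)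
    set M := ⌊R⌋₊ with hMdef
    have hM1 : 1 ≤ M := (Nat.one_le_floor_iff R).mpr hR1
    have hM1' : (1 : ℝ) ≤ M := by exact_mod_cast hM1
    have hMR : (M : ℝ) ≤ R := Nat.floor_le (by linarith)
    have hRM : R / 2 ≤ M := by linarith [Nat.lt_floor_add_one R]
    have hMN : M ^ (n - d) ≤ N := by
      have h1 : (M : ℝ) ^ (n - d) ≤ R ^ (n - d) := pow_le_pow_left₀ (by positivity) hMR _
      have h2 : R ^ (n - d) = N := by
        rw [hR, ← Real.rpow_natCast, hm, ← Real.rpow_mul (by positivity),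
          one_div_mul_cancel hm0.ne', Real.rpow_one]
      rw [h2] at h1
      exact_mod_cast h1
    refine le_trans (ENNReal.ofReal_le_ofReal ?_)
      (le_supLpNorm_of_pow_le hd hdn hr hrn hM1 hMN hp0)
    set α : ℝ := (m + 1 - p) / p with hα
    have hα0 : 0 ≤ α := div_nonneg (by linarith) hp0.le
    have hαn : α ≤ n := by
      rw [hα, div_le_iff₀ hp0]
      have : (0 : ℝ) ≤ d := Nat.cast_nonneg d
      nlinarith
    have hMα : (M : ℝ) ^ α = ((M : ℝ) ^ (n - d + 1)) ^ (1 / p) / M := by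
      rw [← Real.rpow_natCast, ← Real.rpow_mul (by positivity)]
      rw [← Real.rpow_sub_one (by positivity)]
      congr 1
      push_cast
      rw [hm, hα]
      field_simp
    have hNα : (N : ℝ) ^ ((m + 1 - p) / (p * m)) = R ^ α := by
      rw [hR, ← Real.rpow_mul (by positivity), hα]
      congr 1
      field_simp
    have h2α : (2 : ℝ) ^ α ≤ 2 ^ n := by
      rw [← Real.rpow_natCast]
      exact Real.rpow_le_rpow_of_exponent_le (by norm_num) hαn
    have hRα : R ^ α / 2 ^ n ≤ (M : ℝ) ^ α := by
      calc R ^ α / 2 ^ n ≤ R ^ α / 2 ^ α :=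
            div_le_div_of_nonneg_left (by positivity) (by positivity) h2α
        _ = (R / 2) ^ α := (Real.div_rpow (by positivity) (by norm_num) _).symm
        _ ≤ (M : ℝ) ^ α := Real.rpow_le_rpow (by positivity) hRM hα0
    have h12 : (12 : ℝ) ^ n = 2 ^ n * 6 ^ n := by rw [← mul_pow]; norm_num
    rw [hNα]
    calc r ^ d / (48 * 12 ^ n) * R ^ α
        ≤ r ^ d / (12 ^ n) * R ^ α := by
          gcongr
          have : (0 : ℝ) < 12 ^ n := by positivity
          linarith
      _ = r ^ d * (R ^ α / 2 ^ n / 6 ^ n) := by rw [h12]; field_simp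
      _ ≤ r ^ d * ((M : ℝ) ^ α / 6 ^ n) := by gcongr
      _ = r ^ d / M * (((M : ℝ) ^ (n - d + 1)) ^ (1 / p) / 6 ^ n) := by rw [hMα]; ring
      _ ≤ r ^ d / M * ((M : ℝ) ^ (n - d + 1) / 6 ^ n) ^ (1 / p) := by
          refine mul_le_mul_of_nonneg_left ?_ (by positivity)
          exact rpow_div_le_div_rpow (by positivity) (one_le_pow₀ (by norm_num)) hp1.le
  · have hp1 : 1 ≤ p := by linarith
    have hp0 : 0 < p := by linarith
    have hlog4 : Real.log 4 ≤ 2 := by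
      have : (4 : ℝ) = 2 ^ 2 := by norm_num
      rw [this, Real.log_pow]
      push_cast
      linarith [Real.log_two_lt_d9]
    have hlog0 : 0 ≤ Real.log N := Real.log_natCast_nonneg N
    have hN0 : (0 : ℝ) < N := by exact_mod_cast hN
    -- For `N < 4` not even `L = 1` is allowed; the slab with `M = 1` suffices because `log N ≤ 2`.
    by_cases hN4 : N < 4
    · refine le_trans (ENNReal.ofReal_le_ofReal ?_)
        (le_supLpNorm_of_pow_le hd hdn hr hrn le_rfl (by simpa using hN) hp0)
      have hlog : Real.log N ≤ 2 := by
        refine le_trans (Real.log_le_log hN0 ?_) hlog4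
        exact_mod_cast hN4.le
      have h1 : Real.log N ^ (1 / p) ≤ 2 := by
        calc Real.log N ^ (1 / p) ≤ 2 ^ (1 / p) := Real.rpow_le_rpow hlog0 hlog (by positivity)
          _ ≤ 2 ^ (1 : ℝ) := Real.rpow_le_rpow_of_exponent_le (by norm_num)
              (by rw [div_le_one hp0]; exact hp1)
          _ = 2 := Real.rpow_one 2
      have h2 := rpow_div_le_div_rpow (y := 1) (a := 6 ^ n) (p := p) zero_le_one
        (one_le_pow₀ (by norm_num)) hp1
      rw [Real.one_rpow] at h2
      simp only [Nat.cast_one, one_pow, div_one]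
      calc r ^ d / (48 * 12 ^ n) * Real.log N ^ (1 / p) ≤ r ^ d / (48 * 12 ^ n) * 2 := by gcongr
        _ = r ^ d * (1 / (24 * 12 ^ n)) := by field_simp; norm_num
        _ ≤ r ^ d * (1 / 6 ^ n) := by
          gcongr
          have h3 : (6 : ℝ) ^ n ≤ 12 ^ n := pow_le_pow_left₀ (by norm_num) (by norm_num) n
          have : (0 : ℝ) < 12 ^ n := by positivity
          linarith
        _ ≤ _ := by gcongr
    · have hN4' : 4 ≤ N := not_lt.mp hN4
      set L := Nat.log 4 N with hL
      have hL1 : 1 ≤ L := Nat.log_pos (by norm_num) hN4'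
      have hL1' : (1 : ℝ) ≤ L := by exact_mod_cast hL1
      have hLN : 2 ^ (2 * L) ≤ N := by
        rw [pow_mul]
        exact Nat.pow_log_le_self 4 (by omega)
      have hlog : Real.log N ≤ 4 * L := by
        have h1 : (N : ℝ) ≤ 4 ^ (L + 1) := by
          exact_mod_cast (Nat.lt_pow_succ_log_self (by norm_num) N).le
        calc Real.log N ≤ Real.log (4 ^ (L + 1)) := Real.log_le_log hN0 h1
          _ = (L + 1) * Real.log 4 := by rw [Real.log_pow]; push_cast; ring
          _ ≤ (L + 1) * 2 := by gcongr
          _ ≤ 4 * L := by linarith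
      refine le_trans (ENNReal.ofReal_le_ofReal ?_)
        (le_supLpNorm_of_two_pow_le hd hdn hr hrn hL1 hLN hp0)
      have h2 : (2 : ℝ) ^ (n - 2) ≤ 12 ^ n :=
        (pow_le_pow_left₀ (by norm_num) (by norm_num) _).trans
          (pow_le_pow_right₀ (by norm_num) (by omega))
      have hone : (1 : ℝ) ≤ 48 * 12 ^ n := by
        have : (1 : ℝ) ≤ 12 ^ n := one_le_pow₀ (by norm_num)
        linarith
      calc r ^ d / (48 * 12 ^ n) * Real.log N ^ (1 / p)
          = r ^ d * (Real.log N ^ (1 / p) / (48 * 12 ^ n)) := by ring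
        _ ≤ r ^ d * (Real.log N / (48 * 12 ^ n)) ^ (1 / p) := by
            gcongr
            exact rpow_div_le_div_rpow hlog0 hone hp1
        _ ≤ r ^ d * (L / (12 * 2 ^ (n - 2))) ^ (1 / p) := by
            gcongr r ^ d * ?_ ^ (1 / p)
            calc Real.log N / (48 * 12 ^ n) ≤ 4 * L / (48 * 12 ^ n) := by gcongr
              _ = L / (12 * 12 ^ n) := by field_simp; norm_num
              _ ≤ L / (12 * 2 ^ (n - 2)) := by gcongr
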